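/- Let $\mathbf V$ be a finite set of vertices, let $\mathcal G$ be a directed acyclic graph (DAG) on $\mathbf V$, and let $[\mathcal G]$ be its Markov equivalence class, that is, the set of all DAGs on $\mathbf V$ that have the same d-separation relations as $\mathcal G$. Let $\mathcal G^*$ be the completed partially directed acyclic graph (CPDAG) representing $[\mathcal G]$: two vertices are adjacent in $\mathcal G^*$ if and only if they are adjacent in $\mathcal G$; the edge between them is directed as $u\to v$ in $\mathcal G^*$ if and only if $u\to v$ is an edge of every DAG in $[\mathcal G]$; all other edges of $\mathcal G^*$ are undirected. A chain component of $\mathcal G^*$ is a connected component of its undirected subgraph (the graph on $\mathbf V$ whose edges are the undirected edges of $\mathcal G^*$). A vertex $X$ is a cause of a vertex $Y\neq X$ in a DAG if the DAG contains a directed path from $X$ to $Y$, and $X$ is a definite cause of $Y$ if $X$ is a cause of $Y$ in every DAG in $[\mathcal G]$. For any two distinct vertices $X$ and $Y$ in $\mathbf V$, if $X$ is a definite cause of $Y$, then $X$ and $Y$ are not in the same chain component of $\mathcal G^*$. -/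

import Mathlib

namespace CausalGraph

/-- A directed acyclic graph on the vertex set `V`: a directed graph with no directed cycle,
that is, no vertex can be reached from itself along one or more directed edges
(in particular there are no loops and no two opposite edges). -/
structure DAG (V : Type*) extends Digraph V where
  acyclic : ∀ v : V, ¬ Relation.TransGen Adj v v

/-- A partially directed graph on the vertex set `V`: directed edges and undirected edges,
with at most one edge between any two vertices and no loops. -/
structure PartiallyDirectedGraph (V : Type*) where
  /-- The directed subgraph. -/
  directed : Digraph V
  /-- The undirected subgraph. -/
  undirected : SimpleGraph V
  directed_asymm : ∀ u v : V, directed.Adj u v → ¬ directed.Adj v u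
  not_undirected_of_directed : ∀ u v : V, directed.Adj u v → ¬ undirected.Adj u v

/-- A chain component of a partially directed graph: a connected component of its undirected
subgraph. -/
abbrev PartiallyDirectedGraph.ChainComponent {V : Type*} (P : PartiallyDirectedGraph V) : Type _ :=
  P.undirected.ConnectedComponent

namespace DAG

variable {V : Type*}

/-- The skeleton of a DAG: forget the directions of the edges. -/
def skeleton (G : DAG V) : SimpleGraph V := G.toDigraph.toSimpleGraphInclusive

/-- The ancestors of `v`: `v` itself and the vertices with a directed path to `v`. -/
def ancestors (G : DAG V) (v : V) : Set V := {u | Relation.ReflTransGen G.Adj u v}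

/-- The descendants of `v`: `v` itself and the vertices to which `v` has a directed path. -/
def descendants (G : DAG V) (v : V) : Set V := {u | Relation.ReflTransGen G.Adj v u}

/-- `x` is a cause of `y` if `x` is an ancestor of `y` other than `y` itself. -/
def IsCause (G : DAG V) (x y : V) : Prop := x ∈ G.ancestors y \ {y}

/-- The intermediate vertex with index `i + 1` is a collider on the path `p`: both edges of the
path at this vertex point to it. -/
def IsColliderOn (G : DAG V) {x y : V} (p : G.skeleton.Walk x y) (i : ℕ) : Prop :=
  G.Adj (p.getVert i) (p.getVert (i + 1)) ∧ G.Adj (p.getVert (i + 2)) (p.getVert (i + 1))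

/-- The path `p` is d-connected (active) given `Z`: neither an endpoint nor a non-collider of `p`
is in `Z`, and every collider on `p` has a descendant in `Z`. The intermediate vertices of `p` are
those with index `i + 1` where `i + 1 < p.length`. -/
def IsActive (G : DAG V) {x y : V} (p : G.skeleton.Walk x y) (Z : Set V) : Prop :=
  x ∉ Z ∧ y ∉ Z ∧
    (∀ i : ℕ, i + 1 < p.length → ¬ G.IsColliderOn p i → p.getVert (i + 1) ∉ Z) ∧
    (∀ i : ℕ, i + 1 < p.length → G.IsColliderOn p i →
      (G.descendants (p.getVert (i + 1)) ∩ Z).Nonempty)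

/-- `A` and `B` are d-separated by `Z`: every path between a vertex of `A` and a vertex of `B`
is blocked by `Z`. -/
def DSep (G : DAG V) (A B Z : Set V) : Prop :=
  ∀ x ∈ A, ∀ y ∈ B, ∀ p : G.skeleton.Walk x y, p.IsPath → ¬ G.IsActive p Z

/-- The set of d-separation relations read off from `G`: the triples `(A, B, Z)` of pairwise
disjoint sets of vertices such that `A` and `B` are d-separated by `Z`. -/
def dSepRelations (G : DAG V) : Set (Set V × Set V × Set V) :=
  {t | Disjoint t.1 t.2.1 ∧ Disjoint t.1 t.2.2 ∧ Disjoint t.2.1 t.2.2 ∧ G.DSep t.1 t.2.1 t.2.2}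

/-- Two DAGs are Markov equivalent if they have the same d-separation relations. -/
def MarkovEquiv (G H : DAG V) : Prop := G.dSepRelations = H.dSepRelations

/-- The Markov equivalence class of `G`: all DAGs (on the same vertices) equivalent to `G`. -/
def markovClass (G : DAG V) : Set (DAG V) := {H | G.MarkovEquiv H}

/-- `x` is a definite cause of `y`, given the Markov equivalence class of `G`, if `x` is a cause
of `y` in every DAG in this class. -/
def IsDefiniteCause (G : DAG V) (x y : V) : Prop := ∀ H ∈ G.markovClass, H.IsCause x y

/-- The CPDAG representing the Markov equivalence class of `G`: it has the adjacencies of `G`,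
and an edge is directed in it if and only if this directed edge is in every DAG of the class;
the other edges are undirected. -/
def cpdag (G : DAG V) : PartiallyDirectedGraph V where
  directed := { Adj := fun u v => ∀ H ∈ G.markovClass, H.Adj u v }
  undirected :=
    { Adj := fun u v => G.skeleton.Adj u v ∧
        ¬ (∀ H ∈ G.markovClass, H.Adj u v) ∧ ¬ (∀ H ∈ G.markovClass, H.Adj v u)
      symm := ⟨fun _ _ h => ⟨h.1.symm, h.2.2, h.2.1⟩⟩
      loopless := ⟨fun v h => G.skeleton.loopless.irrefl v h.1⟩ }
  directed_asymm := fun u _ h h' =>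
    G.acyclic u ((Relation.TransGen.single (h G rfl)).tail (h' G rfl))
  not_undirected_of_directed := fun _ _ h h' => h'.2.1 h

end DAG

end CausalGraph

/-! If `X` and `Y` lay in one chain component, some DAG of the class would have no directed path
from `X` to `Y`. To build it, keep every edge that Meek's rules compel and orient the others along a
perfect ordering that starts at `Y`.

Meek's lemma (`Compelled.of_undirected`) says that a compelled edge into one vertex of an undirected
component has a parallel edge into every other. Hence the orientation creates no immorality, and a
directed path between two vertices of one component uses undirected edges only, so it increases the
ordering (`lt_of_transGen_oriented`). This gives acyclicity, and also excludes a path ending at `Y`,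
the minimum. The perfect ordering comes from a topological ordering of `G`, rearranged to begin at
`Y` (`exists_perfect_order`).

The new DAG is in the class by the theorem of Verma and Pearl (`SameStructure.markovEquiv`), proved
by reversing covered edges one at a time; the Bayes ball shows that each reversal preserves
d-separation. The converse (`MarkovEquiv.sameStructure`) makes Meek's rules sound for the class. -/

namespace CausalGraph.DAG

open Relation

variable {V : Type*} {G H : DAG V} {Z : Set V} {a b c d u v w x y : V}

/-! ### Adjacency, skeletons and immoralities -/

section Basic

lemma adj_irrefl (G : DAG V) (v : V) : ¬ G.Adj v v := fun h => G.acyclic v (.single h)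

lemma adj_asymm (h : G.Adj u v) : ¬ G.Adj v u :=
  fun h' => G.acyclic u ((TransGen.single h).tail h')

lemma adj_ne (h : G.Adj u v) : u ≠ v := by
  rintro rfl
  exact G.adj_irrefl u h

lemma skeleton_adj_iff : G.skeleton.Adj u v ↔ G.Adj u v ∨ G.Adj v u := by
  simp only [skeleton, Digraph.toSimpleGraphInclusive, SimpleGraph.fromRel_adj]
  refine ⟨fun h => h.2, fun h => ⟨?_, h⟩⟩
  rcases h with h | h
  · exact adj_ne h
  · exact (adj_ne h).symm

lemma adj_of_trans (huv : G.Adj u v) (hvw : G.Adj v w) (h : G.skeleton.Adj u w) : G.Adj u w := by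
  rcases skeleton_adj_iff.1 h with h | h
  · exact h
  · exact (G.acyclic u (((TransGen.single huv).tail hvw).tail h)).elim

@[ext]
lemma ext_adj (h : ∀ u v, G.Adj u v ↔ H.Adj u v) : G = H := by
  rcases G with ⟨⟨A⟩, hA⟩
  rcases H with ⟨⟨B⟩, hB⟩
  have : A = B := by
    funext u v
    exact propext (h u v)
  subst this
  rfl

/-- `a → b ← d` is an immorality (v-structure): `a` and `d` are distinct and nonadjacent. -/
def Immorality (G : DAG V) (a b d : V) : Prop :=
  G.Adj a b ∧ G.Adj d b ∧ a ≠ d ∧ ¬ G.skeleton.Adj a d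

lemma Immorality.symm (h : G.Immorality a b d) : G.Immorality d b a :=
  ⟨h.2.1, h.1, h.2.2.1.symm, fun h' => h.2.2.2 h'.symm⟩

/-- Two DAGs have the same skeleton and the same immoralities. -/
def SameStructure (G H : DAG V) : Prop :=
  G.skeleton = H.skeleton ∧ ∀ a b d, G.Immorality a b d ↔ H.Immorality a b d

lemma SameStructure.symm (h : SameStructure G H) : SameStructure H G :=
  ⟨h.1.symm, fun a b d => (h.2 a b d).symm⟩

lemma SameStructure.trans {K : DAG V} (h : SameStructure G H) (h' : SameStructure H K) :
    SameStructure G K :=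
  ⟨h.1.trans h'.1, fun a b d => (h.2 a b d).trans (h'.2 a b d)⟩

lemma MarkovEquiv.symm (h : MarkovEquiv G H) : MarkovEquiv H G := Eq.symm h

lemma MarkovEquiv.trans {K : DAG V} (h : MarkovEquiv G H) (h' : MarkovEquiv H K) :
    MarkovEquiv G K := Eq.trans h h'

end Basic

/-! ### Markov equivalence determines skeleton and immoralities -/

section Separation

lemma MarkovEquiv.dSep_singleton (h : MarkovEquiv G H) (huv : u ≠ v) (hu : u ∉ Z) (hv : v ∉ Z)
    (hs : G.DSep {u} {v} Z) : H.DSep {u} {v} Z := by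
  have hmem : (({u} : Set V), ({v} : Set V), Z) ∈ G.dSepRelations := by
    refine ⟨?_, ?_, ?_, hs⟩ <;> simp [huv, hu, hv]
  rw [show G.dSepRelations = H.dSepRelations from h] at hmem
  exact hmem.2.2.2

/-- An active path cannot enter `v` through a parent, since that parent would be a non-collider in
the set or `u` itself. So it leaves `v` along an arrow and stays directed: its first collider would
be an ancestor of a parent of `v`, closing a cycle. It would then make `v` an ancestor of `u`. -/
lemma dSep_parents (hadj : ¬ G.skeleton.Adj v u) (hne : v ≠ u)
    (hanc : ¬ ReflTransGen G.Adj v u) : G.DSep {v} {u} {z | G.Adj z v} := by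
  rintro _ rfl _ rfl p - ⟨-, -, hnc, hc⟩
  rename_i v u
  have hlen : 0 < p.length := by
    rcases Nat.eq_zero_or_pos p.length with h0 | h0
    · exact (hne (SimpleGraph.Walk.eq_of_length_eq_zero h0)).elim
    · exact h0
  have key : ∀ i, i < p.length →
      ReflTransGen G.Adj v (p.getVert i) ∧ G.Adj (p.getVert i) (p.getVert (i + 1)) := by
    intro i
    induction i with
    | zero =>
      intro h0
      have hstep := skeleton_adj_iff.1 (p.adj_getVert_succ h0)
      simp only [SimpleGraph.Walk.getVert_zero] at hstep ⊢
      refine ⟨.refl, hstep.resolve_right fun hback => ?_⟩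
      by_cases h1 : 0 + 1 < p.length
      · refine hnc 0 h1 (fun hcol => ?_) hback
        have := hcol.1
        rw [SimpleGraph.Walk.getVert_zero] at this
        exact adj_asymm this hback
      · have hend : p.getVert (0 + 1) = u := by
          rw [show 0 + 1 = p.length by omega, SimpleGraph.Walk.getVert_length]
        rw [hend] at hback
        exact hadj (skeleton_adj_iff.2 (Or.inr hback))
    | succ i ih =>
      intro hi
      obtain ⟨hr, hstep⟩ := ih (by omega)
      have hr' := hr.tail hstep
      refine ⟨hr', (skeleton_adj_iff.1 (p.adj_getVert_succ hi)).resolve_right fun hback => ?_⟩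
      obtain ⟨z, hz, hzv⟩ := hc i hi ⟨hstep, hback⟩
      exact G.acyclic v (TransGen.tail' (hr'.trans hz) hzv)
  obtain ⟨hr, hstep⟩ := key (p.length - 1) (by omega)
  have := hr.tail hstep
  rw [show p.length - 1 + 1 = p.length by omega, SimpleGraph.Walk.getVert_length] at this
  exact hanc this

/-- By acyclicity one of the two vertices is not an ancestor of the other, and its parents separate.
The disjunction avoids the symmetry of d-separation. -/
lemma exists_dSep (hadj : ¬ G.skeleton.Adj u v) (hne : u ≠ v) :
    ∃ Z : Set V, u ∉ Z ∧ v ∉ Z ∧ (G.DSep {u} {v} Z ∨ G.DSep {v} {u} Z) := by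
  by_cases h : ReflTransGen G.Adj v u
  · have h' : ¬ ReflTransGen G.Adj u v := by
      intro h'
      rcases reflTransGen_iff_eq_or_transGen.1 h with h | h
      · exact hne h
      · exact G.acyclic _ (h.trans_left h')
    exact ⟨{z | G.Adj z u}, G.adj_irrefl u, fun h => hadj (skeleton_adj_iff.2 (Or.inr h)),
      Or.inl (dSep_parents hadj hne h')⟩
  · exact ⟨{z | G.Adj z v}, fun h => hadj (skeleton_adj_iff.2 (Or.inl h)), G.adj_irrefl v,
      Or.inr (dSep_parents (fun h => hadj h.symm) hne.symm h)⟩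

lemma not_dSep_of_adj (hadj : G.skeleton.Adj u v) (hu : u ∉ Z) (hv : v ∉ Z) :
    ¬ G.DSep {u} {v} Z := by
  intro h
  refine h u rfl v rfl hadj.toWalk (by simp [hadj.ne]) ⟨hu, hv, ?_, ?_⟩ <;>
  · intro i hi
    simp at hi

lemma not_dSep_of_adj_adj (h1 : G.skeleton.Adj u w) (h2 : G.skeleton.Adj w v) (hne : u ≠ v)
    (hu : u ∉ Z) (hv : v ∉ Z) (hw : w ∈ Z ↔ G.Adj u w ∧ G.Adj v w) : ¬ G.DSep {u} {v} Z := by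
  intro h
  have hcol : G.IsColliderOn (.cons h1 (.cons h2 .nil)) 0 ↔ w ∈ Z := by
    rw [hw]
    rfl
  refine h u rfl v rfl (.cons h1 (.cons h2 .nil)) (by simp [h1.ne, h2.ne, hne])
    ⟨hu, hv, ?_, ?_⟩ <;>
  · intro i hi hi'
    obtain rfl : i = 0 := by simpa using hi
    rw [hcol] at hi'
    first
      | exact hi'
      | exact ⟨w, .refl, hi'⟩

lemma MarkovEquiv.skeleton_le (h : MarkovEquiv G H) (hadj : H.skeleton.Adj u v) :
    G.skeleton.Adj u v := by
  by_contra hG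
  obtain ⟨Z, hu, hv, hs | hs⟩ := exists_dSep hG hadj.ne
  · exact not_dSep_of_adj hadj hu hv (h.dSep_singleton hadj.ne hu hv hs)
  · exact not_dSep_of_adj hadj.symm hv hu (h.dSep_singleton hadj.ne.symm hv hu hs)

lemma MarkovEquiv.skeleton_eq (h : MarkovEquiv G H) : G.skeleton = H.skeleton := by
  ext u v
  exact ⟨h.symm.skeleton_le, h.skeleton_le⟩

/-- A set separating `a` from `d` must omit the collider `b`. It also separates them in `H`, where
omitting `b` blocks the path through `b` only if `b` is a collider there too. -/
lemma MarkovEquiv.immorality (h : MarkovEquiv G H) (hi : G.Immorality a b d) :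
    H.Immorality a b d := by
  obtain ⟨hab, hdb, hne, hadj⟩ := hi
  have main : ∀ {a d : V}, G.Adj a b → G.Adj d b → a ≠ d → ∀ Z : Set V, a ∉ Z → d ∉ Z →
      G.DSep {a} {d} Z → H.Adj a b ∧ H.Adj d b := by
    intro a d hab hdb hne Z ha hd hs
    have hbZ : b ∉ Z := fun hb =>
      not_dSep_of_adj_adj (skeleton_adj_iff.2 (Or.inl hab)) (skeleton_adj_iff.2 (Or.inr hdb)) hne
        ha hd (by simp [hb, hab, hdb]) hs
    have h1 : H.skeleton.Adj a b := h.skeleton_eq ▸ skeleton_adj_iff.2 (Or.inl hab)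
    have h2 : H.skeleton.Adj b d := h.skeleton_eq ▸ skeleton_adj_iff.2 (Or.inr hdb)
    by_contra hcon
    exact not_dSep_of_adj_adj h1 h2 hne ha hd (by simp only [hbZ, hcon])
      (h.dSep_singleton hne ha hd hs)
  have hH : ¬ H.skeleton.Adj a d := h.skeleton_eq ▸ hadj
  obtain ⟨Z, ha, hd, hs | hs⟩ := exists_dSep hadj hne
  · obtain ⟨h1, h2⟩ := main hab hdb hne Z ha hd hs
    exact ⟨h1, h2, hne, hH⟩
  · obtain ⟨h1, h2⟩ := main hdb hab hne.symm Z hd ha hs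
    exact ⟨h2, h1, hne, hH⟩

lemma MarkovEquiv.sameStructure (h : MarkovEquiv G H) : SameStructure G H :=
  ⟨h.skeleton_eq, fun _ _ _ => ⟨h.immorality, h.symm.immorality⟩⟩

end Separation

/-! ### Active paths as reachability by the Bayes ball -/

section BayesBall

/-- Reachability by the Bayes ball started at `a`, given `Z`. The ball is at a vertex, where it
arrived from a child (`true`; this includes the start) or from a parent (`false`). -/
inductive Ball (G : DAG V) (Z : Set V) (a : V) : Bool → V → Prop
  | start : Ball G Z a true a
  | up_up {v w : V} : Ball G Z a true v → v ∉ Z → G.Adj w v → Ball G Z a true w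
  | down {s : Bool} {v w : V} : Ball G Z a s v → v ∉ Z → G.Adj v w → Ball G Z a false w
  | down_up {v w : V} : Ball G Z a false v → v ∈ Z → G.Adj w v → Ball G Z a true w

/-- The Bayes ball can bounce back from a vertex with a descendant in `Z`. -/
lemma Ball.bounce {z : V} (hz : z ∈ Z) (hvz : ReflTransGen G.Adj v z) :
    ∀ {w : V}, Ball G Z a false v → G.Adj w v → Ball G Z a true w := by
  induction hvz using ReflTransGen.head_induction_on with
  | refl => exact fun hb hw => hb.down_up hz hw
  | @head v' _ hvc _ ih =>
    intro w hb hw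
    by_cases hv : v' ∈ Z
    · exact hb.down_up hv hw
    · exact (ih (hb.down hv hvc) hvc).up_up hv hw

/-- The middle vertex of the consecutive vertices `u`, `v`, `w` of a path does not block it. -/
def Passable (G : DAG V) (Z : Set V) (u v w : V) : Prop :=
  (¬ (G.Adj u v ∧ G.Adj w v) → v ∉ Z) ∧
    (G.Adj u v ∧ G.Adj w v → (G.descendants v ∩ Z).Nonempty)

/-- The first `n + 1` terms of `f` form a walk in the skeleton all of whose intermediate vertices
are passable. -/
def ActiveSeq (G : DAG V) (Z : Set V) (n : ℕ) (f : ℕ → V) : Prop :=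
  (∀ i, i < n → G.skeleton.Adj (f i) (f (i + 1))) ∧
    ∀ i, i + 1 < n → G.Passable Z (f i) (f (i + 1)) (f (i + 2))

lemma IsActive.activeSeq {p : G.skeleton.Walk x y} (h : G.IsActive p Z) :
    G.ActiveSeq Z p.length p.getVert :=
  ⟨fun _ hi => p.adj_getVert_succ hi, fun i hi => ⟨h.2.2.1 i hi, h.2.2.2 i hi⟩⟩

lemma ActiveSeq.ball {n : ℕ} {f : ℕ → V} (h : G.ActiveSeq Z n f) (h0 : f 0 ∉ Z) :
    ∃ s, Ball G Z (f 0) s (f n) := by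
  have key : ∀ i, i < n → (G.Adj (f i) (f (i + 1)) → Ball G Z (f 0) false (f (i + 1))) ∧
      (G.Adj (f (i + 1)) (f i) → Ball G Z (f 0) true (f (i + 1))) := by
    intro i
    induction i with
    | zero => exact fun _ => ⟨fun h => Ball.start.down h0 h, fun h => Ball.start.up_up h0 h⟩
    | succ i ih =>
      intro hi
      obtain ⟨ih1, ih2⟩ := ih (by omega)
      obtain ⟨hnc, hc⟩ := h.2 i hi
      rcases skeleton_adj_iff.1 (h.1 i (by omega)) with hin | hin
      · refine ⟨fun hout => ?_, fun hout => ?_⟩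
        · exact (ih1 hin).down (hnc fun h => adj_asymm h.2 hout) hout
        · obtain ⟨z, hz, hzZ⟩ := hc ⟨hin, hout⟩
          exact Ball.bounce hzZ hz (ih1 hin) hout
      · have hZ := hnc fun h => adj_asymm h.1 hin
        exact ⟨fun hout => (ih2 hin).down hZ hout, fun hout => (ih2 hin).up_up hZ hout⟩
  rcases n with _ | n
  · exact ⟨true, .start⟩
  · rcases skeleton_adj_iff.1 (h.1 n (by omega)) with hin | hin
    · exact ⟨_, (key n (by omega)).1 hin⟩
    · exact ⟨_, (key n (by omega)).2 hin⟩

lemma ActiveSeq.extend {n : ℕ} {f : ℕ → V} (h : G.ActiveSeq Z n f)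
    (hw : G.skeleton.Adj (f n) w) (hp : ∀ m, m + 1 = n → G.Passable Z (f m) (f (m + 1)) w) :
    G.ActiveSeq Z (n + 1) (fun k => if k ≤ n then f k else w) := by
  refine ⟨fun i hi => ?_, fun i hi => ?_⟩
  · rcases Nat.lt_or_eq_of_le (Nat.lt_succ_iff.1 hi) with hi | rfl
    · simpa [show i ≤ n by omega, show i + 1 ≤ n by omega] using h.1 i hi
    · simpa using hw
  · rcases Nat.lt_or_eq_of_le (show i + 1 ≤ n by omega) with hi | rfl
    · simpa [show i ≤ n by omega, show i + 1 ≤ n by omega, show i + 2 ≤ n by omega] using h.2 i hi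
    · simpa using hp i rfl

/-- The state of the ball is the direction of the last edge, which decides whether the next step
makes a collider. Writing `m + 1 = n` leaves the start, with no last edge, unconstrained. -/
lemma Ball.exists_activeSeq {s : Bool} (h : Ball G Z a s v) :
    ∃ n f, f 0 = a ∧ f n = v ∧ G.ActiveSeq Z n f ∧
      ∀ m, m + 1 = n → if s then G.Adj (f (m + 1)) (f m) else G.Adj (f m) (f (m + 1)) := by
  have extend : ∀ {s t : Bool} {v w : V}, G.skeleton.Adj v w →
      (if t then G.Adj w v else G.Adj v w) →
      (∀ u, (if s then G.Adj v u else G.Adj u v) → G.Passable Z u v w) →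
      (∃ n f, f 0 = a ∧ f n = v ∧ G.ActiveSeq Z n f ∧
        ∀ m, m + 1 = n → if s then G.Adj (f (m + 1)) (f m) else G.Adj (f m) (f (m + 1))) →
      ∃ n f, f 0 = a ∧ f n = w ∧ G.ActiveSeq Z n f ∧
        ∀ m, m + 1 = n → if t then G.Adj (f (m + 1)) (f m) else G.Adj (f m) (f (m + 1)) := by
    rintro s t v w hadj ht hp ⟨n, f, h0, rfl, hf, hl⟩
    refine ⟨n + 1, fun k => if k ≤ n then f k else w, by simpa using h0, by simp,
      hf.extend hadj ?_, ?_⟩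
    · rintro m rfl
      exact hp _ (hl m rfl)
    · intro m hm
      obtain rfl : m = n := by omega
      simpa using ht
  induction h with
  | start => exact ⟨0, fun _ => a, rfl, rfl, ⟨by simp, by simp⟩, by simp⟩
  | up_up _ hv hw ih =>
    refine extend (skeleton_adj_iff.2 (Or.inr hw)) (by simpa using hw) (fun u hu => ?_) ih
    exact ⟨fun _ => hv, fun h => (adj_asymm h.1 (by simpa using hu)).elim⟩
  | down _ hv hw ih =>
    refine extend (skeleton_adj_iff.2 (Or.inl hw)) (by simpa using hw) (fun u hu => ?_) ih
    exact ⟨fun _ => hv, fun h => (adj_asymm h.2 hw).elim⟩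
  | down_up _ hv hw ih =>
    refine extend (skeleton_adj_iff.2 (Or.inr hw)) (by simpa using hw) (fun u hu => ?_) ih
    exact ⟨fun h => (h ⟨by simpa using hu, hw⟩).elim, fun _ => ⟨_, .refl, hv⟩⟩

/-- Either all edges up to `j` point forward, or the first one that does not makes a collider; this
collider descends from `f i` and has a descendant in `Z`. -/
lemma ActiveSeq.follow {n : ℕ} {f : ℕ → V} (h : G.ActiveSeq Z n f) {i j : ℕ} (hij : i < j)
    (hj : j ≤ n) (hi : G.Adj (f i) (f (i + 1))) :
    (TransGen G.Adj (f i) (f j) ∧ G.Adj (f (j - 1)) (f j)) ∨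
      (G.descendants (f i) ∩ Z).Nonempty := by
  induction j, hij using Nat.le_induction with
  | base => exact Or.inl ⟨.single hi, hi⟩
  | succ j hij ih =>
    rcases ih (by omega) with ⟨hr, hl⟩ | h'
    · obtain ⟨k, rfl⟩ : ∃ k, j = k + 1 := ⟨j - 1, by omega⟩
      simp only [Nat.add_sub_cancel] at hl ⊢
      rcases skeleton_adj_iff.1 (h.1 (k + 1) (by omega)) with hs | hs
      · exact Or.inl ⟨hr.tail hs, hs⟩
      · obtain ⟨z, hz, hzZ⟩ := (h.2 k (by omega)).2 ⟨hl, hs⟩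
        exact Or.inr ⟨z, hr.to_reflTransGen.trans hz, hzZ⟩
    · exact Or.inr h'

/-- Cutting a closed part out of an active sequence leaves an active sequence. -/
lemma ActiveSeq.splice {n i j : ℕ} {f : ℕ → V} (h : G.ActiveSeq Z n f) (hij : i < j)
    (hj : j ≤ n) (heq : f i = f j) :
    G.ActiveSeq Z (n - (j - i)) (fun k => if k ≤ i then f k else f (k + (j - i))) := by
  obtain ⟨e, rfl⟩ : ∃ e, j = i + e := ⟨j - i, by omega⟩
  simp only [Nat.add_sub_cancel_left]
  refine ⟨fun k hk => ?_, fun k hk => ?_⟩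
  · rcases lt_trichotomy k i with hki | rfl | hki
    · simpa [show k ≤ i by omega, show k + 1 ≤ i by omega] using h.1 k (by omega)
    · have := h.1 (k + e) (by omega)
      rw [← heq] at this
      simpa [show k + 1 + e = k + e + 1 by omega] using this
    · simpa [show ¬ k ≤ i by omega, show ¬ k + 1 ≤ i by omega,
        show k + 1 + e = k + e + 1 by omega] using h.1 (k + e) (by omega)
  · rcases lt_trichotomy k i with hki | rfl | hki
    · rcases Nat.lt_or_eq_of_le (show k + 1 ≤ i by omega) with hki' | rfl
      · simpa [show k ≤ i by omega, show k + 1 ≤ i by omega, show k + 2 ≤ i by omega]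
          using h.2 k (by omega)
      · simp only [show k ≤ k + 1 by omega, le_refl, if_true, show ¬ k + 2 ≤ k + 1 by omega,
          if_false]
        have hstep := h.1 (k + 1 + e) (by omega)
        have hp := h.2 k (by omega)
        have hq := h.2 (k + e) (by omega)
        rw [show k + e + 1 = k + 1 + e by omega, ← heq, show k + e + 2 = k + 2 + e by omega] at hq
        -- At the junction, a non-collider has an edge not pointing into it, which already made it a
        -- non-collider at one end of the removed loop. For a collider, the loop either starts with
        -- an arrow into the junction, a collider already, or leaves it; it cannot return directed,
        -- so `follow` finds a descendant in `Z`.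
        refine ⟨fun hnc => ?_, fun hc => ?_⟩
        · by_cases hin : G.Adj (f k) (f (k + 1))
          · exact hq.1 fun h => hnc ⟨hin, h.2⟩
          · exact hp.1 fun h => hin h.1
        · rcases skeleton_adj_iff.1 (h.1 (k + 1) (by omega)) with hs | hs
          · rcases h.follow hij hj hs with h' | h'
            · rw [← heq] at h'
              exact (G.acyclic _ h'.1).elim
            · exact h'
          · exact hp.2 ⟨hc.1, hs⟩
    · have := h.2 (k + e) (by omega)
      rw [← heq] at this
      simpa [show k + 1 + e = k + e + 1 by omega, show k + 2 + e = k + e + 2 by omega] using this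
    · simpa [show ¬ k ≤ i by omega, show ¬ k + 1 ≤ i by omega, show ¬ k + 2 ≤ i by omega,
        show k + 1 + e = k + e + 1 by omega, show k + 2 + e = k + e + 2 by omega]
        using h.2 (k + e) (by omega)

lemma ActiveSeq.exists_injOn {n : ℕ} {f : ℕ → V} (h : G.ActiveSeq Z n f) :
    ∃ m g, g 0 = f 0 ∧ g m = f n ∧ G.ActiveSeq Z m g ∧ Set.InjOn g {i | i ≤ m} := by
  induction n using Nat.strong_induction_on generalizing f with
  | _ n ih =>
    by_cases hinj : ∀ i j, i < j → j ≤ n → f i ≠ f j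
    · refine ⟨n, f, rfl, rfl, h, fun i hi j hj hij => ?_⟩
      simp only [Set.mem_ofPred_eq] at hi hj
      rcases lt_trichotomy i j with h' | h' | h'
      · exact (hinj i j h' hj hij).elim
      · exact h'
      · exact (hinj j i h' hi hij.symm).elim
    · push Not at hinj
      obtain ⟨i, j, hij, hj, heq⟩ := hinj
      obtain ⟨m, g, h0, hm, hg⟩ := ih (n - (j - i)) (by omega) (h.splice hij hj heq)
      refine ⟨m, g, by simpa using h0, hm.trans ?_, hg⟩
      rcases Nat.lt_or_eq_of_le hj with hj' | rfl
      · simp [show ¬ n - (j - i) ≤ i by omega, show n - (j - i) + (j - i) = n by omega]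
      · simp [show j - (j - i) = i by omega, heq]

lemma exists_walk_getVert {S : SimpleGraph V} {n : ℕ} {f : ℕ → V}
    (h : ∀ i, i < n → S.Adj (f i) (f (i + 1))) :
    ∃ p : S.Walk (f 0) (f n), p.length = n ∧ ∀ i ≤ n, p.getVert i = f i := by
  induction n generalizing f with
  | zero => exact ⟨.nil, rfl, fun i hi => by rw [Nat.le_zero.1 hi]; rfl⟩
  | succ n ih =>
    obtain ⟨p, hl, hp⟩ := ih (f := fun i => f (i + 1)) fun i hi => h (i + 1) (by omega)
    refine ⟨.cons (h 0 (by omega)) p, by simp [hl], fun i hi => ?_⟩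
    rcases i with _ | i
    · rfl
    · exact hp i (by omega)

lemma exists_isActive_iff :
    (∃ p : G.skeleton.Walk a b, p.IsPath ∧ G.IsActive p Z) ↔
      a ∉ Z ∧ b ∉ Z ∧ ∃ s, Ball G Z a s b := by
  constructor
  · rintro ⟨p, -, hp⟩
    have := hp.activeSeq.ball (by simpa using hp.1)
    simp only [SimpleGraph.Walk.getVert_zero, SimpleGraph.Walk.getVert_length] at this
    exact ⟨hp.1, hp.2.1, this⟩
  · rintro ⟨ha, hb, s, hs⟩
    obtain ⟨n, f, h0, hn, hf, -⟩ := hs.exists_activeSeq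
    obtain ⟨m, g, h0', hm, hg, hinj⟩ := hf.exists_injOn
    obtain ⟨p, hl, hp⟩ := exists_walk_getVert hg.1
    obtain rfl : g 0 = a := h0'.trans h0
    obtain rfl : g m = b := hm.trans hn
    refine ⟨p, (SimpleGraph.Walk.IsPath.getVert_injOn_iff p).1 ?_, ha, hb, ?_, ?_⟩
    · intro i hi j hj hij
      rw [hl] at hi hj
      rw [hp i hi, hp j hj] at hij
      exact hinj hi hj hij
    · rw [hl]
      intro i hi
      simp only [IsColliderOn, hp i (by omega), hp (i + 1) (by omega), hp (i + 2) (by omega)]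
      exact (hg.2 i hi).1
    · rw [hl]
      intro i hi
      simp only [IsColliderOn, hp i (by omega), hp (i + 1) (by omega), hp (i + 2) (by omega)]
      exact (hg.2 i hi).2

lemma dSep_iff_ball {A B : Set V} :
    G.DSep A B Z ↔ ∀ x ∈ A, ∀ y ∈ B, x ∉ Z → y ∉ Z → ∀ s, ¬ Ball G Z x s y := by
  have : G.DSep A B Z ↔ ∀ x ∈ A, ∀ y ∈ B,
      ¬ ∃ p : G.skeleton.Walk x y, p.IsPath ∧ G.IsActive p Z := by
    simp only [DSep, not_exists, not_and]
  simp only [this, exists_isActive_iff, not_and, not_exists]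

end BayesBall

/-! ### Reversing a covered edge -/

section CoveredReversal

/-- `H` is obtained from `G` by reversing the covered edge `x → y`. -/
structure CoveredReversal (G H : DAG V) (x y : V) : Prop where
  adj : G.Adj x y
  adj_rev : H.Adj y x
  covered : ∀ z, z ≠ x → (G.Adj z y ↔ G.Adj z x)
  adj_iff : ∀ u v, ¬ (u = x ∧ v = y) → ¬ (u = y ∧ v = x) → (G.Adj u v ↔ H.Adj u v)

lemma CoveredReversal.symm (h : CoveredReversal G H x y) : CoveredReversal H G y x where
  adj := h.adj_rev
  adj_rev := h.adj
  covered z hz := by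
    by_cases hzx : z = x
    · subst hzx
      simp [H.adj_irrefl z, adj_asymm h.adj_rev]
    · rw [← h.adj_iff z x (by tauto) (by tauto), ← h.adj_iff z y (by tauto) (by tauto)]
      exact (h.covered z hzx).symm
  adj_iff u v h1 h2 := (h.adj_iff u v h2 h1).symm

/-- Where the ball gets in `H` if it reaches `v` in `G`: outside of `{x, y}` the same states are
reachable, and at `x` and `y` states from which the ball can go on in the same ways. -/
lemma Ball.of_coveredReversal {s : Bool} (h : CoveredReversal G H x y) (hb : Ball G Z a s v) :
    (v ≠ x → v ≠ y → Ball H Z a s v) ∧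
    (v = x → s = true → x ∉ Z → (y ∉ Z → Ball H Z a true y) ∧
      (y ∈ Z → Ball H Z a true x ∨ (Ball H Z a false x ∧ Ball H Z a false y))) ∧
    (v = y → s = true → y ∉ Z → Ball H Z a true y) ∧
    (v = x → s = false → Ball H Z a false x ∧ Ball H Z a false y) ∧
    (v = y → s = false → (Ball H Z a false x ∧ Ball H Z a false y) ∨
      (x ∉ Z ∧ y ∉ Z ∧ Ball H Z a true y) ∨ (x ∉ Z ∧ y ∈ Z ∧ Ball H Z a true x)) := by
  have hxy : x ≠ y := adj_ne h.adj
  have hyx : H.Adj y x := h.adj_rev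
  have up : ∀ {u v}, Ball H Z a true v → v ∉ Z → H.Adj u v → Ball H Z a true u :=
    fun h1 h2 h3 => h1.up_up h2 h3
  have down : ∀ {s u v}, Ball H Z a s v → v ∉ Z → H.Adj v u → Ball H Z a false u :=
    fun h1 h2 h3 => h1.down h2 h3
  have bounce : ∀ {u v}, Ball H Z a false v → v ∈ Z → H.Adj u v → Ball H Z a true u :=
    fun h1 h2 h3 => h1.down_up h2 h3
  have hadj := h.adj_iff
  have hcov := h.covered
  have hirr := G.adj_irrefl
  -- Each rule uses only one edge and membership of the current vertex in `Z`; covering lets a third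
  -- vertex that is a parent of `x` or `y` serve for both.
  by_cases hxZ : x ∈ Z <;> by_cases hyZ : y ∈ Z
  all_goals
    induction hb with
    | start => grind [Ball.start]
    | @up_up v w hb hv hw ih =>
      clear hb
      by_cases hvx : v = x <;> by_cases hvy : v = y <;> by_cases hwx : w = x <;>
        by_cases hwy : w = y <;> grind
    | @down s v w hb hv hw ih =>
      clear hb
      cases s <;> by_cases hvx : v = x <;> by_cases hvy : v = y <;> by_cases hwx : w = x <;>
        by_cases hwy : w = y <;> grind
    | @down_up v w hb hv hw ih =>
      clear hb
      by_cases hvx : v = x <;> by_cases hvy : v = y <;> by_cases hwx : w = x <;>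
        by_cases hwy : w = y <;> grind

end CoveredReversal

/-! ### The theorem of Verma and Pearl -/

section MarkovEquivalence

lemma CoveredReversal.dSep {A B : Set V} (h : CoveredReversal G H x y) (hs : H.DSep A B Z) :
    G.DSep A B Z := by
  rw [dSep_iff_ball] at hs ⊢
  intro a ha b hb haZ hbZ s hball
  have hno := hs a ha b hb haZ hbZ
  obtain ⟨h1, h2, h3, h4, h5⟩ := hball.of_coveredReversal h
  have hdown : Ball H Z a true y → y ∉ Z → Ball H Z a false x := fun h1 h2 => h1.down h2 h.adj_rev
  have hup : Ball H Z a true x → x ∉ Z → Ball H Z a true y := fun h1 h2 => h1.up_up h2 h.adj_rev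
  by_cases hbx : b = x
  · subst hbx
    cases s <;> grind
  · by_cases hby : b = y
    · subst hby
      cases s <;> grind
    · exact hno s (h1 hbx hby)

lemma CoveredReversal.markovEquiv (h : CoveredReversal G H x y) : MarkovEquiv G H := by
  ext t
  have : G.DSep t.1 t.2.1 t.2.2 ↔ H.DSep t.1 t.2.1 t.2.2 := ⟨h.symm.dSep, h.dSep⟩
  simp only [dSepRelations, Set.mem_ofPred_eq, this]

lemma acyclic_of_insert {r : V → V → Prop} (h : ∀ v, ¬ TransGen r v v)
    (hxy : ¬ ReflTransGen r x y) (v : V) :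
    ¬ TransGen (fun a b => r a b ∨ (a = y ∧ b = x)) v v := by
  have key : ∀ u v, TransGen (fun a b => r a b ∨ (a = y ∧ b = x)) u v →
      TransGen r u v ∨ (ReflTransGen r u y ∧ ReflTransGen r x v) := by
    intro u v huv
    induction huv with
    | single h =>
      rcases h with h | ⟨rfl, rfl⟩
      · exact Or.inl (.single h)
      · exact Or.inr ⟨.refl, .refl⟩
    | tail _ hbc ih =>
      rcases hbc with hbc | ⟨rfl, rfl⟩
      · exact ih.imp (fun ih => ih.tail hbc) fun ih => ⟨ih.1, ih.2.tail hbc⟩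
      · exact Or.inr ⟨ih.elim (fun ih => ih.to_reflTransGen) fun ih => ih.1, .refl⟩
  intro hv
  rcases key v v hv with h' | ⟨h1, h2⟩
  · exact h v h'
  · exact hxy (h2.trans h1)

/-- Another directed path from `x` to `y` would end with a parent of `y` other than `x`. By covering
this is a parent of `x`, so `G` would have a cycle. -/
lemma exists_coveredReversal (hxy : G.Adj x y) (hcov : ∀ z, z ≠ x → (G.Adj z y ↔ G.Adj z x)) :
    ∃ K : DAG V, CoveredReversal G K x y := by
  have hacyc : ∀ v,
      ¬ TransGen (fun a b => (G.Adj a b ∧ ¬ (a = x ∧ b = y)) ∨ (a = y ∧ b = x)) v v := by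
    refine acyclic_of_insert (fun v hv => G.acyclic v (hv.lift id fun _ _ h => h.1)) fun hr => ?_
    rcases ReflTransGen.cases_tail hr with heq | ⟨z, hz, hzy, hzx⟩
    · exact adj_ne hxy heq.symm
    · have hzx' : z ≠ x := fun h => hzx ⟨h, rfl⟩
      exact G.acyclic x (TransGen.tail' (hz.lift id fun _ _ h => h.1) ((hcov z hzx').1 hzy))
  refine ⟨⟨⟨_⟩, hacyc⟩, hxy, Or.inr ⟨rfl, rfl⟩, hcov, fun u v h1 h2 => ?_⟩
  simp [h1, h2]

lemma CoveredReversal.skeleton_le (h : CoveredReversal G H x y) (huv : G.skeleton.Adj u v) :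
    H.skeleton.Adj u v := by
  rw [skeleton_adj_iff] at huv ⊢
  have h1 := h.adj_iff u v
  have h2 := h.adj_iff v u
  have h3 := h.adj_rev
  by_cases hu : u = x <;> by_cases hv : v = y <;> by_cases hu' : u = y <;>
    by_cases hv' : v = x <;> grind

lemma CoveredReversal.immorality (h : CoveredReversal G H x y) (hi : G.Immorality a b d) :
    H.Immorality a b d := by
  obtain ⟨hab, hdb, hne, hadj⟩ := hi
  refine ⟨?_, ?_, hne, fun h' => hadj (h.symm.skeleton_le h')⟩
  all_goals
    rw [skeleton_adj_iff] at hadj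
    have h1 := h.adj_iff a b
    have h2 := h.adj_iff d b
    have h3 := h.covered a
    have h4 := h.covered d
    have h5 := adj_asymm h.adj
    by_cases hbx : b = x <;> by_cases hby : b = y <;> by_cases hax : a = x <;>
      by_cases hdx : d = x <;> grind

lemma CoveredReversal.sameStructure (h : CoveredReversal G H x y) : SameStructure G H := by
  refine ⟨?_, fun _ _ _ => ⟨h.immorality, h.symm.immorality⟩⟩
  ext u v
  exact ⟨h.skeleton_le, h.symm.skeleton_le⟩

lemma exists_rank [Finite V] (G : DAG V) : ∃ ρ : V → ℕ, ∀ u v, G.Adj u v → ρ u < ρ v := by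
  refine ⟨fun v => {u | TransGen G.Adj u v}.ncard, fun u v huv => ?_⟩
  refine Set.ncard_lt_ncard ⟨fun w hw => TransGen.tail hw huv, fun h => ?_⟩ (Set.toFinite _)
  exact G.acyclic u (h (TransGen.single huv : TransGen G.Adj u v))

lemma SameStructure.adj_or (h : SameStructure G H) (huv : G.Adj u v) : H.Adj u v ∨ H.Adj v u :=
  skeleton_adj_iff.1 (h.1 ▸ skeleton_adj_iff.2 (Or.inl huv))

/-- Chickering's lemma: if two distinct DAGs have the same skeleton and the same immoralities, then
some edge on whose direction they differ is covered in the first one. -/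
lemma SameStructure.exists_covered [Finite V] (h : SameStructure G H) (hne : G ≠ H) :
    ∃ x y, G.Adj x y ∧ H.Adj y x ∧ ∀ z, z ≠ x → (G.Adj z y ↔ G.Adj z x) := by
  obtain ⟨ρ, hρ⟩ := G.exists_rank
  have hrev : {v | ∃ u, G.Adj u v ∧ H.Adj v u}.Nonempty := by
    by_contra hemp
    have hGH : ∀ u v, G.Adj u v → H.Adj u v := fun u v huv =>
      (h.adj_or huv).resolve_right fun h' => hemp ⟨v, u, huv, h'⟩
    refine hne (ext_adj fun u v => ⟨hGH u v, fun huv => ?_⟩)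
    exact (h.symm.adj_or huv).resolve_right fun h' => adj_asymm huv (hGH _ _ h')
  -- Take `y` lowest among the heads of reversed edges, then `x` highest among its reversed parents.
  -- Edges into vertices below `y` therefore agree in both DAGs, and so do edges into `y` from
  -- parents above `x`.
  obtain ⟨y, hy, hymin⟩ := Set.exists_min_image _ ρ (Set.toFinite _) hrev
  obtain ⟨x, ⟨hxy, hyx⟩, hxmax⟩ :=
    Set.exists_max_image {u | G.Adj u y ∧ H.Adj y u} ρ (Set.toFinite _) hy
  have keep : ∀ {u v}, G.Adj u v → ρ v < ρ y → H.Adj u v := fun {u v} huv hv =>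
    (h.adj_or huv).resolve_right fun h' => absurd (hymin v ⟨u, huv, h'⟩) (by omega)
  refine ⟨x, y, hxy, hyx, fun z hzx => ⟨fun hzy => ?_, fun hzx' => ?_⟩⟩
  · by_cases hadj : G.skeleton.Adj z x
    · refine (skeleton_adj_iff.1 hadj).resolve_right fun hxz => ?_
      have hyz : ¬ H.Adj y z := fun hyz =>
        absurd (hxmax z ⟨hzy, hyz⟩) (by have := hρ _ _ hxz; omega)
      have hzy' := (h.adj_or hzy).resolve_right hyz
      have hxz' := keep hxz (hρ _ _ hzy)
      exact H.acyclic z (((TransGen.single hzy').tail hyx).tail hxz')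
    · exact (adj_asymm hyx ((h.2 z y x).1 ⟨hzy, hxy, hzx, hadj⟩).2.1).elim
  · have hzx'' := keep hzx' (hρ _ _ hxy)
    by_cases hadj : G.skeleton.Adj z y
    · exact adj_of_trans hzx' hxy hadj
    · have hzy : z ≠ y := by
        rintro rfl
        exact adj_asymm hxy hzx'
      exact (adj_asymm hxy ((h.2 z x y).2 ⟨hzx'', hyx, hzy, h.1 ▸ hadj⟩).2.1).elim

/-- The theorem of Verma and Pearl: DAGs with the same skeleton and the same immoralities are
Markov equivalent. -/
lemma SameStructure.markovEquiv [Finite V] (h : SameStructure G H) : MarkovEquiv G H := by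
  induction hn : {p : V × V | G.Adj p.1 p.2 ∧ H.Adj p.2 p.1}.ncard using Nat.strong_induction_on
    generalizing G with
  | _ n ih =>
    by_cases hne : G = H
    · subst hne
      rfl
    · obtain ⟨x, y, hxy, hyx, hcov⟩ := h.exists_covered hne
      obtain ⟨K, hK⟩ := exists_coveredReversal hxy hcov
      refine hK.markovEquiv.trans (ih _ ?_ (hK.sameStructure.symm.trans h) rfl)
      -- The reversal removes the disagreement at `x → y` and adds none.
      rw [← hn]
      refine Set.ncard_lt_ncard ⟨fun p hp => ?_, fun hsub => ?_⟩ (Set.toFinite _)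
      · have h1 := hp.1
        rw [← hK.adj_iff p.1 p.2] at h1
        · exact ⟨h1, hp.2⟩
        · rintro ⟨h3, h4⟩
          exact adj_asymm hK.adj_rev (h3 ▸ h4 ▸ hp.1)
        · rintro ⟨h3, h4⟩
          exact adj_asymm hyx (h3 ▸ h4 ▸ hp.2)
      · exact adj_asymm hK.adj_rev (hsub (show (x, y) ∈ _ from ⟨hxy, hyx⟩)).1

end MarkovEquivalence

/-! ### Meek's rules and Meek's lemma -/

section Compelled

/-- The edges that the immoralities of `G` direct via Meek's first three rules. -/
inductive Compelled (G : DAG V) : V → V → Prop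
  | immorality {a b d : V} : G.Immorality a b d → Compelled G a b
  | chain {d a b : V} : Compelled G d a → G.skeleton.Adj a b → d ≠ b → ¬ G.skeleton.Adj d b →
      ¬ G.Immorality d a b → Compelled G a b
  | trans {a d b : V} : Compelled G a d → Compelled G d b → G.skeleton.Adj a b → Compelled G a b
  | kite {a b d e : V} : G.skeleton.Adj a b → G.skeleton.Adj a d → G.skeleton.Adj a e →
      Compelled G d b → Compelled G e b → d ≠ e → ¬ G.skeleton.Adj d e →
      ¬ G.Immorality d a e → Compelled G a b

/-- Soundness of the rules: the opposite direction would create a cycle or a new immorality. -/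
lemma Compelled.adj_of_sameStructure (hc : Compelled G a b) (h : SameStructure G H) :
    H.Adj a b := by
  induction hc with
  | immorality hi => exact ((h.2 _ _ _).1 hi).1
  | @chain d a b _ hab hne hdb hi ih =>
    rw [h.1] at hab hdb
    refine (skeleton_adj_iff.1 hab).resolve_right fun hba => hi ?_
    exact (h.2 _ _ _).2 ⟨ih, hba, hne, hdb⟩
  | trans _ _ hab ih1 ih2 => exact adj_of_trans ih1 ih2 (h.1 ▸ hab)
  | @kite a b d e hab had hae _ _ hne hde hi ih1 ih2 =>
    rw [h.1] at hab had hae hde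
    refine (skeleton_adj_iff.1 hab).resolve_right fun hba => hi ?_
    exact (h.2 _ _ _).2 ⟨adj_of_trans ih1 hba had.symm, adj_of_trans ih2 hba hae.symm, hne, hde⟩

lemma Compelled.adj (hc : Compelled G a b) : G.Adj a b :=
  hc.adj_of_sameStructure ⟨rfl, fun _ _ _ => Iff.rfl⟩

lemma Compelled.skeleton_adj (hc : Compelled G a b) : G.skeleton.Adj a b :=
  skeleton_adj_iff.2 (Or.inl hc.adj)

/-- The edges that Meek's rules leave undirected. -/
def Undirected (G : DAG V) (u v : V) : Prop :=
  G.skeleton.Adj u v ∧ ¬ Compelled G u v ∧ ¬ Compelled G v u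

lemma Undirected.symm (h : G.Undirected u v) : G.Undirected v u := ⟨h.1.symm, h.2.2, h.2.1⟩

lemma undirected_or (h : G.skeleton.Adj u v) :
    G.Undirected u v ∨ Compelled G u v ∨ Compelled G v u := by
  by_cases h1 : Compelled G u v <;> by_cases h2 : Compelled G v u <;> simp [Undirected, *]

lemma Undirected.not_immorality (h : G.Undirected u v) : ¬ G.Immorality u v w :=
  fun hi => h.2.1 (.immorality hi)

lemma Undirected.not_immorality' (h : G.Undirected u v) : ¬ G.Immorality w v u :=
  fun hi => h.not_immorality hi.symm

lemma Compelled.or_undirected (hc : Compelled G a b) (hu : G.Undirected b c) :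
    Compelled G a c ∨ G.Undirected a c := by
  have hne : a ≠ c := by
    rintro rfl
    exact hu.2.2 hc
  have hadj : G.skeleton.Adj a c := by
    by_contra hadj
    exact hu.2.1 (hc.chain hu.1 hne hadj hu.symm.not_immorality')
  rcases undirected_or hadj with hac | hac | hac
  · exact Or.inr hac
  · exact Or.inl hac
  · exact (hu.2.2 (hac.trans hc hu.1.symm)).elim

/-- Meek's lemma: a compelled edge into an end of an undirected edge has a compelled companion into
the other end. -/
lemma Compelled.of_undirected (hc : Compelled G a b) (hu : G.Undirected b c) :
    Compelled G a c := by
  induction hc generalizing c with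
  | @immorality a b d hi =>
    -- If `a – c` were undirected, then either `d → c` is compelled and the chain rule compels `c →
    -- a`, or `d – c` is undirected and the kite rule compels `c → b`.
    refine (Compelled.or_undirected (.immorality hi) hu).resolve_right fun hac => ?_
    have hdb : Compelled G d b := .immorality hi.symm
    have had : ¬ G.skeleton.Adj d a := fun h => hi.2.2.2 h.symm
    rcases hdb.or_undirected hu with hd | hd
    · exact hac.2.2 (hd.chain hac.1.symm hi.2.2.1.symm had hac.not_immorality')
    · exact hu.2.2 (.kite hu.1.symm hac.1.symm hd.1.symm (.immorality hi) hdb hi.2.2.1 hi.2.2.2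
        hac.not_immorality)
  | @chain d a b hda hab hdb hdbadj hi ih =>
    refine (Compelled.or_undirected (hda.chain hab hdb hdbadj hi) hu).resolve_right fun hac => ?_
    exact hu.2.2 ((ih hac).chain hu.1.symm hdb hdbadj hu.not_immorality')
  | @trans a d b had hdb hab ih1 ih2 =>
    rcases (had.trans hdb hab).or_undirected hu with hac | hac
    · exact hac
    · exact had.trans (ih2 hu) hac.1
  | @kite a b d e hab had hae hdb heb hne hde hi ih1 ih2 =>
    rcases (Compelled.kite hab had hae hdb heb hne hde hi).or_undirected hu with hac | hac
    · exact hac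
    · exact .kite hac.1 had hae (ih1 hu) (ih2 hu) hne hde hi

end Compelled

/-! ### Perfect orderings of the undirected edges -/

section PerfectOrder

/-- If a symmetric relation has a perfect ordering (the earlier neighbours of each vertex are
pairwise related), then it has one in which a given clique comes first. -/
lemma exists_perfect_order {U : V → V → Prop} (hU : ∀ {u v}, U u v → U v u) {ρ : V → ℕ}
    (hρ : ∀ {u v w}, U u w → U v w → u ≠ v → ρ u ≤ ρ w → ρ v ≤ ρ w → U u v) (A : Finset V) :
    ∀ K : Set V, K ⊆ A → (∀ u ∈ K, ∀ v ∈ K, u ≠ v → U u v) →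
      ∃ r : V → ℕ, Set.InjOn r A ∧
        (∀ u ∈ A, ∀ v ∈ A, ∀ w ∈ A, U u w → U v w → u ≠ v → r u < r w → r v < r w → U u v) ∧
        ∀ k ∈ K, ∀ v ∈ A, v ∉ K → r k < r v := by
  classical
  induction A using Finset.induction_on_max_value ρ with
  | empty => exact fun K hK _ => ⟨ρ, by simp, by simp, by simp⟩
  | insert t A ht hmax ih =>
    have bound : ∀ r : V → ℕ, ∃ M, ∀ v ∈ A, r v < M := fun r =>
      ⟨A.sup r + 1, fun v hv => Nat.lt_succ_of_le (Finset.le_sup hv)⟩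
    intro K hKA hK
    by_cases htK : t ∈ K
    · obtain ⟨r, hinj, hmoral, hfirst⟩ := ih {v | v ∈ A ∧ U v t} (fun v hv => hv.1)
        fun u hu v hv huv => hρ hu.2 hv.2 huv (hmax u hu.1) (hmax v hv.1)
      obtain ⟨M, hM⟩ := bound r
      have hKN : ∀ v ∈ K, v ≠ t → v ∈ A ∧ U v t := fun v hv hvt =>
        ⟨(Finset.mem_insert.1 (hKA hv)).resolve_left hvt, hK v hv t htK hvt⟩
      have hmem : ∀ {v}, v ∈ insert t A → v ≠ t → v ∈ A := fun h h' =>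
        (Finset.mem_insert.1 h).resolve_left h'
      -- As `r < M` on `A`, the four blocks are disjoint and increasing: the rest of `K`, then `t`,
      -- then the other neighbours of `t`, then everything else.
      let f : V → ℕ := fun v => if v = t then M else if v ∈ K then r v else
        if U v t then M + 1 + r v else 2 * M + 1 + r v
      refine ⟨f, fun u hu v hv huv => ?_, fun u hu v hv w hw huw hvw hne hlu hlv => ?_,
        fun k hk v hv hvK => ?_⟩
      · simp only [f] at huv
        by_cases hut : u = t <;> by_cases hvt : v = t
        · exact hut.trans hvt.symm
        · have := hM v (hmem hv hvt)
          rw [if_pos hut, if_neg hvt] at huv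
          split_ifs at huv <;> omega
        · have := hM u (hmem hu hut)
          rw [if_neg hut, if_pos hvt] at huv
          split_ifs at huv <;> omega
        · have h1 := hM u (hmem hu hut)
          have h2 := hM v (hmem hv hvt)
          rw [if_neg hut, if_neg hvt] at huv
          refine hinj (hmem hu hut) (hmem hv hvt) ?_
          split_ifs at huv <;> omega
      · by_cases hwN : w = t ∨ U w t
        · have hfw : f w ≤ 2 * M := by
            dsimp only [f]
            by_cases hwt : w = t
            · rw [if_pos hwt]
              omega
            · have := hM w (hmem hw hwt)
              rw [if_neg hwt, if_pos (hwN.resolve_left hwt)]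
              split_ifs <;> omega
          have low : ∀ z ∈ insert t A, f z < f w → z = t ∨ (z ∈ A ∧ U z t) := by
            intro z hz hlz
            by_contra hcon
            push Not at hcon
            have hzA := hmem hz hcon.1
            have hzK : z ∉ K := fun h => hcon.2 hzA (hKN z h hcon.1).2
            have hfz : f z = 2 * M + 1 + r z := by simp [f, hcon.1, hzK, hcon.2 hzA]
            omega
          rcases low u hu hlu with rfl | ⟨huA, hut⟩
          · rcases low v hv hlv with rfl | ⟨-, hvt⟩
            · exact (hne rfl).elim
            · exact hU hvt
          · rcases low v hv hlv with rfl | ⟨hvA, hvt⟩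
            · exact hut
            · exact hρ hut hvt hne (hmax u huA) (hmax v hvA)
        · push Not at hwN
          have hwA := hmem hw hwN.1
          have hwK : w ∉ K := fun h => hwN.2 (hKN w h hwN.1).2
          have hfw : f w = 2 * M + 1 + r w := by simp [f, hwN.1, hwK, hwN.2]
          have low : ∀ z ∈ insert t A, U z w → f z < f w → z ∈ A ∧ r z < r w := by
            intro z hz hzw hlz
            have hzt : z ≠ t := by
              rintro rfl
              exact hwN.2 (hU hzw)
            have hzA := hmem hz hzt
            refine ⟨hzA, ?_⟩
            by_cases hzU : U z t
            · exact hfirst z ⟨hzA, hzU⟩ w hwA fun h => hwN.2 h.2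
            · have hzK : z ∉ K := fun h => hzU (hKN z h hzt).2
              have hfz : f z = 2 * M + 1 + r z := by simp [f, hzt, hzK, hzU]
              omega
          obtain ⟨huA, hu'⟩ := low u hu huw hlu
          obtain ⟨hvA, hv'⟩ := low v hv hvw hlv
          exact hmoral u huA v hvA w hwA huw hvw hne hu' hv'
      · have hvt : v ≠ t := fun h => hvK (h ▸ htK)
        have hfk : f k ≤ M := by
          dsimp only [f]
          by_cases hkt : k = t
          · rw [if_pos hkt]
          · rw [if_neg hkt, if_pos hk]
            exact (hM k (hmem (hKA hk) hkt)).le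
        have hfv : M < f v := by
          dsimp only [f]
          rw [if_neg hvt, if_neg hvK]
          split_ifs <;> omega
        omega
    · obtain ⟨r, hinj, hmoral, hfirst⟩ := ih K (fun v hv =>
        (Finset.mem_insert.1 (hKA hv)).resolve_left fun h => htK (h ▸ hv)) hK
      obtain ⟨M, hM⟩ := bound r
      have hne : ∀ v ∈ A, v ≠ t := fun v hv h => ht (h ▸ hv)
      refine ⟨fun v => if v = t then M else r v, ?_, ?_, ?_⟩
      · intro u hu v hv huv
        rcases Finset.mem_insert.1 hu with hut | huA <;>
          rcases Finset.mem_insert.1 hv with hvt | hvA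
        · exact hut.trans hvt.symm
        · have := hM v hvA
          simp only [hut, hne v hvA, if_true, if_false] at huv
          omega
        · have := hM u huA
          simp only [hvt, hne u huA, if_true, if_false] at huv
          omega
        · simp only [hne u huA, hne v hvA, if_false] at huv
          exact hinj huA hvA huv
      · intro u hu v hv w hw huw hvw huv hlu hlv
        simp only at hlu hlv
        have low : ∀ z ∈ insert t A, (if z = t then M else r z) < (if w = t then M else r w) →
            z ∈ A := by
          intro z hz hlz
          refine (Finset.mem_insert.1 hz).resolve_left fun h => ?_
          rw [if_pos h] at hlz
          split_ifs at hlz with hwt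
          · omega
          · have := hM w ((Finset.mem_insert.1 hw).resolve_left hwt)
            omega
        have huA := low u hu hlu
        have hvA := low v hv hlv
        rcases Finset.mem_insert.1 hw with rfl | hwA
        · exact hρ huw hvw huv (hmax u huA) (hmax v hvA)
        · simp only [hne u huA, hne v hvA, hne w hwA, if_false] at hlu hlv
          exact hmoral u huA v hvA w hwA huw hvw huv hlu hlv
      · intro k hk v hv hvK
        have hkt : k ≠ t := fun h => htK (h ▸ hk)
        have hkA := (Finset.mem_insert.1 (hKA hk)).resolve_left hkt
        simp only [hkt, if_false]
        split_ifs with hvt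
        · exact hM k hkA
        · exact hfirst k hk v ((Finset.mem_insert.1 hv).resolve_left hvt) hvK

/-- The undirected edges can be ordered perfectly with any given vertex first. -/
lemma exists_undirected_order [Finite V] (G : DAG V) (y : V) :
    ∃ r : V → ℕ, Function.Injective r ∧
      (∀ u v w, G.Undirected u w → G.Undirected v w → u ≠ v → r u < r w → r v < r w →
        G.Undirected u v) ∧ ∀ v, v ≠ y → r y < r v := by
  obtain ⟨ρ, hρ⟩ := G.exists_rank
  have toAdj : ∀ {u w}, G.Undirected u w → ρ u ≤ ρ w → G.Adj u w := fun {u w} h hle =>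
    (skeleton_adj_iff.1 h.1).resolve_right fun h' => by
      have := hρ _ _ h'
      omega
  have := Fintype.ofFinite V
  -- The rank `ρ` of `G` is perfect: nonadjacent earlier neighbours would form an immorality with an
  -- undirected edge, and a compelled edge between them would compel another by Meek's lemma.
  obtain ⟨r, hinj, hmoral, hfirst⟩ := exists_perfect_order (U := G.Undirected) (ρ := ρ)
    (fun h => h.symm) (fun {u v w} huw hvw hne hu hv => by
      have huw' := toAdj huw hu
      have hvw' := toAdj hvw hv
      by_cases hadj : G.skeleton.Adj u v
      · rcases undirected_or hadj with h | h | h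
        · exact h
        · exact (huw.2.1 (h.of_undirected hvw)).elim
        · exact (hvw.2.1 (h.of_undirected huw)).elim
      · exact (huw.not_immorality ⟨huw', hvw', hne, hadj⟩).elim)
    Finset.univ {y} (by simp) (by rintro u rfl v rfl h; exact (h rfl).elim)
  refine ⟨r, fun u v h => hinj (by simp) (by simp) h, ?_, fun v hv => ?_⟩
  · exact fun u v w => hmoral u (by simp) v (by simp) w (by simp)
  · exact hfirst y rfl v (by simp) hv

end PerfectOrder

/-! ### Orienting the undirected edges along the ordering -/

section Orientation

lemma transGen_compelled_of_undirected (h : TransGen G.Compelled u v)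
    (hvw : ReflTransGen G.Undirected v w) : TransGen G.Compelled u w := by
  induction hvw with
  | refl => exact h
  | tail _ hu ih =>
    rcases TransGen.tail'_iff.1 ih with ⟨z, hz, hc⟩
    exact TransGen.tail' hz (hc.of_undirected hu)

/-- Direct the compelled edges as compelled and the undirected ones by increasing `r`. -/
def Oriented (G : DAG V) (r : V → ℕ) (u v : V) : Prop :=
  G.Compelled u v ∨ (G.Undirected u v ∧ r u < r v)

/-- By Meek's lemma, undirected steps after a compelled edge can be absorbed into it. -/
lemma transGen_oriented {r : V → ℕ} (h : TransGen (G.Oriented r) u v) :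
    (ReflTransGen G.Undirected u v ∧ r u < r v) ∨
      ∃ w, ReflTransGen G.Undirected u w ∧ TransGen G.Compelled w v := by
  induction h with
  | single h =>
    rcases h with h | ⟨h, hr⟩
    · exact Or.inr ⟨u, .refl, .single h⟩
    · exact Or.inl ⟨.single h, hr⟩
  | tail _ h ih =>
    rcases ih with ⟨hu, hr⟩ | ⟨w, hw, hc⟩ <;> rcases h with h | ⟨h, hr'⟩
    · exact Or.inr ⟨_, hu, .single h⟩
    · exact Or.inl ⟨hu.tail h, hr.trans hr'⟩
    · exact Or.inr ⟨w, hw, hc.tail h⟩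
    · exact Or.inr ⟨w, hw, transGen_compelled_of_undirected hc (.single h)⟩

lemma not_transGen_compelled (v : V) : ¬ TransGen G.Compelled v v := fun h =>
  G.acyclic v (h.lift id fun _ _ hc => hc.adj)

/-- A compelled part of the path could be redirected within the undirected component to end where it
began, giving a cycle in `G`. -/
lemma lt_of_transGen_oriented {r : V → ℕ} (h : TransGen (G.Oriented r) u v)
    (hvu : ReflTransGen G.Undirected v u) : r u < r v := by
  rcases transGen_oriented h with h | ⟨w, hw, hc⟩
  · exact h.2
  · exact (not_transGen_compelled w
      (transGen_compelled_of_undirected (transGen_compelled_of_undirected hc hvu) hw)).elim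

/-- The orientation of the undirected edges by `r`, as a DAG. -/
def orient (G : DAG V) (r : V → ℕ) : DAG V where
  Adj := G.Oriented r
  acyclic _ h := lt_irrefl _ (lt_of_transGen_oriented h .refl)

lemma sameStructure_orient {r : V → ℕ} (hinj : Function.Injective r)
    (hmoral : ∀ u v w, G.Undirected u w → G.Undirected v w → u ≠ v → r u < r w → r v < r w →
      G.Undirected u v) : SameStructure G (G.orient r) := by
  have hskel : G.skeleton = (G.orient r).skeleton := by
    ext u v
    rw [skeleton_adj_iff (G := G.orient r)]
    constructor
    · intro h
      rcases undirected_or h with hu | hc | hc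
      · rcases lt_or_gt_of_ne (hinj.ne h.ne) with hr | hr
        · exact Or.inl (Or.inr ⟨hu, hr⟩)
        · exact Or.inr (Or.inr ⟨hu.symm, hr⟩)
      · exact Or.inl (Or.inl hc)
      · exact Or.inr (Or.inl hc)
    · rintro ((h | h) | (h | h))
      · exact h.skeleton_adj
      · exact h.1.1
      · exact h.skeleton_adj.symm
      · exact h.1.1.symm
  refine ⟨hskel, fun a b d => ⟨fun h => ?_, fun ⟨hab, hdb, hne, hadj⟩ => ?_⟩⟩
  · exact ⟨Or.inl (.immorality h), Or.inl (.immorality h.symm), h.2.2.1, hskel ▸ h.2.2.2⟩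
  · rw [← hskel] at hadj
    -- Two compelled edges lie in `G`; one compelled and one undirected edge have adjacent tails by
    -- Meek's lemma; two undirected ones do because the ordering is perfect.
    rcases hab with hab | ⟨hab, hra⟩ <;> rcases hdb with hdb | ⟨hdb, hrd⟩
    · exact ⟨hab.adj, hdb.adj, hne, hadj⟩
    · exact (hadj (hab.of_undirected hdb.symm).skeleton_adj).elim
    · exact (hadj (hdb.of_undirected hab.symm).skeleton_adj.symm).elim
    · exact (hadj (hmoral a d b hab hdb hne hra hrd).1).elim

/-- Only soundness of the rules is needed: the components under Meek's rules may a priori be larger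
than the chain components. -/
lemma undirected_of_cpdag (h : G.cpdag.undirected.Adj u v) : G.Undirected u v :=
  ⟨h.1, fun hc => h.2.1 fun _ hH => hc.adj_of_sameStructure (MarkovEquiv.sameStructure hH),
    fun hc => h.2.2 fun _ hH => hc.adj_of_sameStructure (MarkovEquiv.sameStructure hH)⟩

end Orientation

end CausalGraph.DAG

open CausalGraph.DAG Relation in
theorem proposition1 {V : Type*} [Finite V] (G : CausalGraph.DAG V) (X Y : V) (hXY : X ≠ Y)
    (hcause : G.IsDefiniteCause X Y) :
    ¬ ∃ c : G.cpdag.ChainComponent, X ∈ c.supp ∧ Y ∈ c.supp := by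
  rintro ⟨c, hX, hY⟩
  have hreach : G.cpdag.undirected.Reachable Y X :=
    SimpleGraph.ConnectedComponent.exact (hY.trans hX.symm)
  have hYX : ReflTransGen G.Undirected Y X :=
    ((SimpleGraph.reachable_iff_reflTransGen _ _).1 hreach).lift id fun _ _ => undirected_of_cpdag
  obtain ⟨r, hinj, hmoral, hfirst⟩ := G.exists_undirected_order Y
  have hanc : ReflTransGen (G.Oriented r) X Y :=
    (hcause _ (sameStructure_orient hinj hmoral).markovEquiv).1
  have htrans := (reflTransGen_iff_eq_or_transGen.1 hanc).resolve_left hXY.symm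
  exact lt_asymm (hfirst X hXY) (lt_of_transGen_oriented htrans hYX)
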